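/- **Theorem.** Let $R$ be a commutative semiring such that for every integer $k\ge 1$ the element $k\cdot 1\in R$ is invertible. Let $\mathsf{MOD}_R$ be the symmetric monoidal category of $R$-modules and $R$-linear maps, with tensor product $\otimes=\otimes_R$, unit $R$ and pointwise addition of maps. Let $\mathsf{Sym}$ be the free symmetric algebra monad on $\mathsf{MOD}_R$: its unit is the inclusion $M\to\mathsf{Sym}(M)$ of the generators, and its multiplication $\mathsf{Sym}(\mathsf{Sym}(M))\to\mathsf{Sym}(M)$ is the algebra morphism extending the identity. Then $\mathsf{MOD}_R^{op}$, with the comonad $\mathsf{Sym}$, is a differential linear category with antiderivatives. Explicitly (writing composition in diagrammatic order, $\oc=\mathsf{Sym}$ on $\mathsf{MOD}_R^{op}$, and $\rho,\varepsilon$ for the comultiplication and counit of the comonad): 1. $\oc$ is a monoidal coalgebra modality. That is, there are natural maps $\Delta_M:\oc M\to\oc M\otimes\oc M$ and $\mathsf e_M:\oc M\to R$ making each $\oc M$ a cocommutative comonoid and each $\rho_M$ a comonoid morphism, together with a natural map $\mathsf m_{M,N}:\oc M\otimes\oc N\to\oc(M\otimes N)$ and a map $\mathsf m_R:R\to\oc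 R$ that make $\oc$ a symmetric monoidal functor, such that $\rho,\varepsilon,\Delta,\mathsf e$ are monoidal transformations and $\Delta,\mathsf e$ are $\oc$-coalgebra morphisms. Read in $\mathsf{MOD}_R$, $\Delta_M$ and $\mathsf e_M$ are the multiplication and the unit of the algebra $\mathsf{Sym}(M)$, and $\mathsf m_{M,N}:\mathsf{Sym}(M\otimes N)\to\mathsf{Sym}(M)\otimes\mathsf{Sym}(N)$ and $\mathsf m_R:\mathsf{Sym}(R)\to R$ are the algebra morphisms given on generators by $x\otimes y\mapsto x\otimes y$ and $r\mapsto r$. 2. There is a deriving transformation, that is, a natural map $\mathsf d_M:\oc M\otimes M\to\oc M$ satisfying the constant, Leibniz, linear, chain and interchange rules. Read in $\mathsf{MOD}_R$, it is polynomial differentiation: the derivation $\mathsf d_M:\mathsf{Sym}(M)\to\mathsf{Sym}(M)\otimes M$ with $\mathsf d_M(x)=1\otimes x$ for $x\in M$. For $M=R$, under $\mathsf{Sym}(R)\cong R[x]$ and $\mathsf{Sym}(R)\otimes R\cong\mathsf{Sym}(R)$, it is the usual derivative $\mathsf d_R\big(\sum_k r_kx^k\big)=\sum_{k\ge1}(k\cdot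 r_k)x^{k-1}$. 3. The differential category has antiderivatives: with $\mathsf d^\circ_M:=\Delta_M(1\otimes\varepsilon_M):\oc M\to\oc M\otimes M$, the natural transformation $\mathsf K_M:=\mathsf d^\circ_M\mathsf d_M+\oc(0):\oc M\to\oc M$ is a natural isomorphism. 4. The component at the monoidal unit of the antiderivative integral transformation $\mathsf s_M:=\mathsf K_M^{-1}\mathsf d^\circ_M:\oc M\to\oc M\otimes M$, regarded as a map $\mathsf s_R:\oc R\to\oc R$, satisfies the Second Fundamental Theorem of Calculus $\mathsf s_R\mathsf d_R+\oc(0)=1_{\oc R}$. Read in $\mathsf{MOD}_R$, it is ordinary polynomial integration on $R[x]\cong\mathsf{Sym}(R)$: $$\mathsf s_R\Big(\sum_{k=0}^n r_kx^k\Big)=\sum_{k=0}^n\big((k+1)^{-1}\cdot r_k\big)x^{k+1}.$$ -/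

import Mathlib

open CategoryTheory MonoidalCategory Opposite
open scoped TensorProduct

universe v u

/-! ## Additive symmetric monoidal categories -/

/-- A category enriched over commutative monoids (no negatives, no biproducts). -/
class CMonEnriched (C : Type u) [Category.{v} C] where
  homAddCommMonoid : ∀ A B : C, AddCommMonoid (A ⟶ B)
  add_comp : ∀ {A B D : C} (f g : A ⟶ B) (h : B ⟶ D), (f + g) ≫ h = f ≫ h + g ≫ h
  comp_add : ∀ {A B D : C} (k : A ⟶ B) (f g : B ⟶ D), k ≫ (f + g) = k ≫ f + k ≫ g
  zero_comp : ∀ {A B D : C} (h : B ⟶ D), (0 : A ⟶ B) ≫ h = 0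
  comp_zero : ∀ {A B D : C} (k : A ⟶ B), k ≫ (0 : B ⟶ D) = 0

attribute [instance, reducible] CMonEnriched.homAddCommMonoid

/-- An additive symmetric monoidal category: the tensor product of maps is additive in each
variable. -/
class AdditiveMonoidal (C : Type u) [Category.{v} C] [MonoidalCategory C] [SymmetricCategory C]
    [CMonEnriched C] : Prop where
  tensor_add : ∀ {A B A' B' : C} (k : A ⟶ B) (f g : A' ⟶ B'),
    k ⊗ₘ (f + g) = k ⊗ₘ f + k ⊗ₘ g
  add_tensor : ∀ {A B A' B' : C} (f g : A ⟶ B) (h : A' ⟶ B'),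
    (f + g) ⊗ₘ h = f ⊗ₘ h + g ⊗ₘ h
  tensor_zero : ∀ {A B A' B' : C} (k : A ⟶ B), k ⊗ₘ (0 : A' ⟶ B') = 0
  zero_tensor : ∀ {A B A' B' : C} (h : A' ⟶ B'), (0 : A ⟶ B) ⊗ₘ h = 0

/-! ## Coalgebra modalities -/

section Modalities

variable {C : Type u} [Category.{v} C] [MonoidalCategory C] [SymmetricCategory C]

/-- A coalgebra modality on the comonad `T = (!, ρ, ε)`, where `ρ = T.δ`: natural maps
`Δ_A : !A ⟶ !A ⊗ !A` and `e_A : !A ⟶ 𝟙_` that make every `!A` a cocommutative comonoid, such that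
every `ρ_A` is a morphism of comonoids. -/
structure CoalgebraModality (T : Comonad C) where
  Δ : ∀ A : C, T.obj A ⟶ T.obj A ⊗ T.obj A
  e : ∀ A : C, T.obj A ⟶ 𝟙_ C
  Δ_natural : ∀ {A B : C} (f : A ⟶ B), T.map f ≫ Δ B = Δ A ≫ (T.map f ⊗ₘ T.map f)
  e_natural : ∀ {A B : C} (f : A ⟶ B), T.map f ≫ e B = e A
  coassoc : ∀ A : C, Δ A ≫ (Δ A ▷ T.obj A) ≫ (α_ _ _ _).hom = Δ A ≫ (T.obj A ◁ Δ A)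
  counit_left : ∀ A : C, Δ A ≫ (e A ▷ T.obj A) ≫ (λ_ (T.obj A)).hom = 𝟙 (T.obj A)
  counit_right : ∀ A : C, Δ A ≫ (T.obj A ◁ e A) ≫ (ρ_ (T.obj A)).hom = 𝟙 (T.obj A)
  cocomm : ∀ A : C, Δ A ≫ (β_ (T.obj A) (T.obj A)).hom = Δ A
  ρ_Δ : ∀ A : C, Δ A ≫ (T.δ.app A ⊗ₘ T.δ.app A) = T.δ.app A ≫ Δ (T.obj A)
  ρ_e : ∀ A : C, T.δ.app A ≫ e (T.obj A) = e A

/-- A monoidal coalgebra modality: a coalgebra modality together with a natural transformation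
`m_{A,B} : !A ⊗ !B ⟶ !(A ⊗ B)` and a map `m_R : 𝟙_ ⟶ !𝟙_` (here `mUnit`), such that `!` is a
symmetric monoidal functor, `ρ`, `ε`, `Δ`, `e` are monoidal transformations, and `Δ`, `e` are
morphisms of `!`-coalgebras. -/
structure MonoidalCoalgebraModality (T : Comonad C) extends CoalgebraModality T where
  m : ∀ A B : C, T.obj A ⊗ T.obj B ⟶ T.obj (A ⊗ B)
  mUnit : 𝟙_ C ⟶ T.obj (𝟙_ C)
  m_natural : ∀ {A B A' B' : C} (f : A ⟶ A') (g : B ⟶ B'),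
    (T.map f ⊗ₘ T.map g) ≫ m A' B' = m A B ≫ T.map (f ⊗ₘ g)
  -- symmetric monoidal functor
  m_assoc : ∀ A B D : C,
    (m A B ▷ T.obj D) ≫ m (A ⊗ B) D ≫ T.map (α_ A B D).hom =
      (α_ (T.obj A) (T.obj B) (T.obj D)).hom ≫ (T.obj A ◁ m B D) ≫ m A (B ⊗ D)
  m_unit_left : ∀ A : C,
    (mUnit ▷ T.obj A) ≫ m (𝟙_ C) A ≫ T.map (λ_ A).hom = (λ_ (T.obj A)).hom
  m_unit_right : ∀ A : C,
    (T.obj A ◁ mUnit) ≫ m A (𝟙_ C) ≫ T.map (ρ_ A).hom = (ρ_ (T.obj A)).hom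
  m_symm : ∀ A B : C,
    (β_ (T.obj A) (T.obj B)).hom ≫ m B A = m A B ≫ T.map (β_ A B).hom
  -- `ρ` and `ε` are monoidal transformations
  m_ρ : ∀ A B : C,
    m A B ≫ T.δ.app (A ⊗ B) =
      (T.δ.app A ⊗ₘ T.δ.app B) ≫ m (T.obj A) (T.obj B) ≫ T.map (m A B)
  m_ε : ∀ A B : C, m A B ≫ T.ε.app (A ⊗ B) = T.ε.app A ⊗ₘ T.ε.app B
  mUnit_ρ : mUnit ≫ T.δ.app (𝟙_ C) = mUnit ≫ T.map mUnit
  mUnit_ε : mUnit ≫ T.ε.app (𝟙_ C) = 𝟙 (𝟙_ C)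
  -- `Δ` and `e` are monoidal transformations
  m_Δ : ∀ A B : C,
    m A B ≫ Δ (A ⊗ B) =
      (Δ A ⊗ₘ Δ B) ≫ tensorμ (T.obj A) (T.obj A) (T.obj B) (T.obj B) ≫ (m A B ⊗ₘ m A B)
  m_e : ∀ A B : C, m A B ≫ e (A ⊗ B) = (e A ⊗ₘ e B) ≫ (λ_ (𝟙_ C)).hom
  mUnit_Δ : mUnit ≫ Δ (𝟙_ C) = (λ_ (𝟙_ C)).inv ≫ (mUnit ⊗ₘ mUnit)
  mUnit_e : mUnit ≫ e (𝟙_ C) = 𝟙 (𝟙_ C)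
  -- `Δ` and `e` are morphisms of `!`-coalgebras
  ρ_map_Δ : ∀ A : C,
    T.δ.app A ≫ T.map (Δ A) = Δ A ≫ (T.δ.app A ⊗ₘ T.δ.app A) ≫ m (T.obj A) (T.obj A)
  ρ_map_e : ∀ A : C, T.δ.app A ≫ T.map (e A) = e A ≫ mUnit

/-- The coderiving transformation `d°_A = Δ_A (1 ⊗ ε_A) : !A ⟶ !A ⊗ A`. -/
def CoalgebraModality.coderiving {T : Comonad C} (W : CoalgebraModality T) (A : C) :
    T.obj A ⟶ T.obj A ⊗ A :=
  W.Δ A ≫ (T.obj A ◁ T.ε.app A)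

theorem CoalgebraModality.coderiving_natural {T : Comonad C} (W : CoalgebraModality T)
    {A B : C} (f : A ⟶ B) :
    T.map f ≫ W.coderiving B = W.coderiving A ≫ (T.map f ⊗ₘ f) := by
  have h : T.map f ≫ T.ε.app B = T.ε.app A ≫ f := T.ε.naturality f
  simp only [CoalgebraModality.coderiving, ← Category.assoc, W.Δ_natural]
  simp only [Category.assoc, ← id_tensorHom, tensorHom_comp_tensorHom, Category.comp_id,
    Category.id_comp, h]

/-! ## Differential linear categories and antiderivatives -/

variable [CMonEnriched C] [AdditiveMonoidal C]

/-- A deriving transformation for a coalgebra modality. -/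
structure DerivingTransformation {T : Comonad C} (W : CoalgebraModality T) where
  d : ∀ A : C, T.obj A ⊗ A ⟶ T.obj A
  d_natural : ∀ {A B : C} (f : A ⟶ B), (T.map f ⊗ₘ f) ≫ d B = d A ≫ T.map f
  constant_rule : ∀ A : C, d A ≫ W.e A = 0
  leibniz_rule : ∀ A : C,
    d A ≫ W.Δ A =
      (W.Δ A ▷ A) ≫ (α_ _ _ _).hom ≫ (T.obj A ◁ (β_ (T.obj A) A).hom) ≫ (α_ _ _ _).inv ≫
          (d A ▷ T.obj A) +
        (W.Δ A ▷ A) ≫ (α_ _ _ _).hom ≫ (T.obj A ◁ d A)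
  linear_rule : ∀ A : C, d A ≫ T.ε.app A = (W.e A ▷ A) ≫ (λ_ A).hom
  chain_rule : ∀ A : C,
    d A ≫ T.δ.app A = (W.Δ A ▷ A) ≫ (α_ _ _ _).hom ≫ (T.δ.app A ⊗ₘ d A) ≫ d (T.obj A)
  interchange_rule : ∀ A : C,
    (d A ▷ A) ≫ d A =
      (α_ _ _ _).hom ≫ (T.obj A ◁ (β_ A A).hom) ≫ (α_ _ _ _).inv ≫ (d A ▷ A) ≫ d A

/-- The structure of a differential linear category on the additive symmetric monoidal category
`C` equipped with the comonad `T`: a monoidal coalgebra modality and a deriving transformation. -/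
structure DifferentialLinearStructure (T : Comonad C) extends MonoidalCoalgebraModality T where
  deriving_ : DerivingTransformation toCoalgebraModality

namespace DifferentialLinearStructure

variable {T : Comonad C} (D : DifferentialLinearStructure T)

/-- The deriving transformation `d_A : !A ⊗ A ⟶ !A`. -/
abbrev d (A : C) : T.obj A ⊗ A ⟶ T.obj A := D.deriving_.d A

/-- The natural transformation `K_A = d°_A d_A + !(0) : !A ⟶ !A`. -/
def K : T.toFunctor ⟶ T.toFunctor where
  app A := D.coderiving A ≫ D.d A + T.map (0 : A ⟶ A)
  naturality A B f := by
    rw [CMonEnriched.comp_add, CMonEnriched.add_comp, ← Category.assoc, D.coderiving_natural,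
      Category.assoc, Category.assoc, D.deriving_.d_natural, ← T.map_comp, ← T.map_comp,
      CMonEnriched.comp_zero, CMonEnriched.zero_comp]

/-- A differential category has antiderivatives if `K` is a natural isomorphism. -/
def HasAntiderivatives : Prop := IsIso D.K

/-- The antiderivative integral transformation `s_A = K_A⁻¹ d°_A : !A ⟶ !A ⊗ A`. -/
noncomputable def integral (h : D.HasAntiderivatives) (A : C) : T.obj A ⟶ T.obj A ⊗ A :=
  haveI : IsIso D.K := h
  (inv D.K).app A ≫ D.coderiving A

/-- The deriving transformation at the monoidal unit, as a map `!R ⟶ !R`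
(using `!R ⊗ R ≅ !R`). -/
def dUnit : T.obj (𝟙_ C) ⟶ T.obj (𝟙_ C) :=
  (ρ_ (T.obj (𝟙_ C))).inv ≫ D.d (𝟙_ C)

/-- The antiderivative integral transformation at the monoidal unit, as a map `!R ⟶ !R`. -/
noncomputable def integralUnit (h : D.HasAntiderivatives) : T.obj (𝟙_ C) ⟶ T.obj (𝟙_ C) :=
  D.integral h (𝟙_ C) ≫ (ρ_ (T.obj (𝟙_ C))).hom

/-- A map `s : !R ⟶ !R` satisfies the Second Fundamental Theorem of Calculus if
`s d_R + !(0) = 1`. -/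
def SatisfiesFTC2 (s : T.obj (𝟙_ C) ⟶ T.obj (𝟙_ C)) : Prop :=
  s ≫ D.dUnit + T.map (0 : 𝟙_ C ⟶ 𝟙_ C) = 𝟙 (T.obj (𝟙_ C))

end DifferentialLinearStructure

end Modalities

/-! ## Opposite categories -/

section Opposites

variable {C : Type u} [Category.{v} C]

instance symmetricCategoryOp [MonoidalCategory C] [SymmetricCategory C] :
    SymmetricCategory Cᵒᵖ where
  symmetry X Y := Quiver.Hom.unop_inj (SymmetricCategory.symmetry (unop X) (unop Y))

instance cmonEnrichedOp [CMonEnriched C] : CMonEnriched Cᵒᵖ where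
  homAddCommMonoid A B := (opEquiv A B).addCommMonoid
  add_comp f g h := Quiver.Hom.unop_inj (CMonEnriched.comp_add h.unop f.unop g.unop)
  comp_add k f g := Quiver.Hom.unop_inj (CMonEnriched.add_comp f.unop g.unop k.unop)
  zero_comp h := Quiver.Hom.unop_inj (CMonEnriched.comp_zero h.unop)
  comp_zero k := Quiver.Hom.unop_inj (CMonEnriched.zero_comp k.unop)

instance additiveMonoidalOp [MonoidalCategory C] [SymmetricCategory C] [CMonEnriched C]
    [AdditiveMonoidal C] : AdditiveMonoidal Cᵒᵖ where
  tensor_add k f g := Quiver.Hom.unop_inj (AdditiveMonoidal.tensor_add k.unop f.unop g.unop)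
  add_tensor f g h := Quiver.Hom.unop_inj (AdditiveMonoidal.add_tensor f.unop g.unop h.unop)
  tensor_zero k := Quiver.Hom.unop_inj (AdditiveMonoidal.tensor_zero k.unop)
  zero_tensor h := Quiver.Hom.unop_inj (AdditiveMonoidal.zero_tensor h.unop)

/-- A monad on `C`, seen as a comonad on `Cᵒᵖ`. -/
def Monad.opComonad (S : Monad C) : Comonad Cᵒᵖ where
  toFunctor := S.toFunctor.op
  ε := { app := fun X => (S.η.app (unop X)).op
         naturality := fun _ _ f => Quiver.Hom.unop_inj (S.η.naturality f.unop).symm }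
  δ := { app := fun X => (S.μ.app (unop X)).op
         naturality := fun _ _ f => Quiver.Hom.unop_inj (S.μ.naturality f.unop).symm }
  coassoc X := Quiver.Hom.unop_inj (S.assoc (unop X))
  left_counit X := Quiver.Hom.unop_inj (S.left_unit (unop X))
  right_counit X := Quiver.Hom.unop_inj (S.right_unit (unop X))

end Opposites

/-! ## Modules over a commutative semiring and the symmetric algebra -/

noncomputable section Sym

variable (R : Type u) [CommSemiring R]

instance semimoduleCMonEnriched : CMonEnriched (SemimoduleCat.{u} R) where
  homAddCommMonoid _ _ := inferInstance
  add_comp f g h := SemimoduleCat.hom_ext (LinearMap.comp_add f.hom g.hom h.hom)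
  comp_add k f g := SemimoduleCat.hom_ext (LinearMap.add_comp k.hom g.hom f.hom)
  zero_comp h := SemimoduleCat.hom_ext (LinearMap.comp_zero h.hom)
  comp_zero k := SemimoduleCat.hom_ext (LinearMap.zero_comp k.hom)

instance semimoduleAdditiveMonoidal : AdditiveMonoidal (SemimoduleCat.{u} R) where
  tensor_add k f g := SemimoduleCat.hom_ext (TensorProduct.map_add_right k.hom f.hom g.hom)
  add_tensor f g h := SemimoduleCat.hom_ext (TensorProduct.map_add_left f.hom g.hom h.hom)
  tensor_zero k := SemimoduleCat.hom_ext (TensorProduct.map_zero_right k.hom)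
  zero_tensor h := SemimoduleCat.hom_ext (TensorProduct.map_zero_left h.hom)

/-- The action of `Sym` on linear maps: the algebra morphism extending `ι ∘ f`. -/
def symMap {M N : Type u} [AddCommMonoid M] [Module R M] [AddCommMonoid N] [Module R N]
    (f : M →ₗ[R] N) : SymmetricAlgebra R M →ₐ[R] SymmetricAlgebra R N :=
  SymmetricAlgebra.lift (SymmetricAlgebra.ι R N ∘ₗ f)

/-- The free symmetric algebra as an endofunctor of the category of `R`-modules. -/
def symFunctor : SemimoduleCat.{u} R ⥤ SemimoduleCat.{u} R where
  obj M := SemimoduleCat.of R (SymmetricAlgebra R M)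
  map f := SemimoduleCat.ofHom (symMap R f.hom).toLinearMap
  map_id M := by
    have h : symMap R (𝟙 M : M ⟶ M).hom = AlgHom.id R _ :=
      SymmetricAlgebra.algHom_ext (LinearMap.ext fun x => by simp [symMap])
    rw [h]; rfl
  map_comp f g := by
    have h : symMap R (f ≫ g).hom = (symMap R g.hom).comp (symMap R f.hom) :=
      SymmetricAlgebra.algHom_ext (LinearMap.ext fun x => by simp [symMap])
    rw [h]; rfl

/-- The free symmetric algebra monad: the unit is the inclusion `ι` of the generators, and the
multiplication `Sym (Sym M) ⟶ Sym M` is the algebra morphism extending the identity of `Sym M`. -/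
def symMonad : Monad (SemimoduleCat.{u} R) where
  toFunctor := symFunctor R
  η := { app := fun M => SemimoduleCat.ofHom (SymmetricAlgebra.ι R M)
         naturality := fun M N f => by
          refine SemimoduleCat.hom_ext (LinearMap.ext fun x => ?_)
          exact (SymmetricAlgebra.lift_ι_apply (SymmetricAlgebra.ι R N ∘ₗ f.hom) x).symm }
  μ := { app := fun M =>
          SemimoduleCat.ofHom (SymmetricAlgebra.lift
            (LinearMap.id : SymmetricAlgebra R M →ₗ[R] SymmetricAlgebra R M)).toLinearMap
         naturality := fun M N f => by
          have h : (SymmetricAlgebra.lift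
                (LinearMap.id : SymmetricAlgebra R N →ₗ[R] SymmetricAlgebra R N)).comp
                (symMap R (symMap R f.hom).toLinearMap) =
              (symMap R f.hom).comp (SymmetricAlgebra.lift
                (LinearMap.id : SymmetricAlgebra R M →ₗ[R] SymmetricAlgebra R M)) :=
            SymmetricAlgebra.algHom_ext (LinearMap.ext fun x => by simp [symMap])
          exact SemimoduleCat.hom_ext (congrArg AlgHom.toLinearMap h) }
  assoc M := by
    have h : (SymmetricAlgebra.lift
          (LinearMap.id : SymmetricAlgebra R M →ₗ[R] SymmetricAlgebra R M)).comp
          (symMap R (SymmetricAlgebra.lift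
            (LinearMap.id : SymmetricAlgebra R M →ₗ[R] SymmetricAlgebra R M)).toLinearMap) =
        (SymmetricAlgebra.lift
          (LinearMap.id : SymmetricAlgebra R M →ₗ[R] SymmetricAlgebra R M)).comp
          (SymmetricAlgebra.lift (LinearMap.id : SymmetricAlgebra R (SymmetricAlgebra R M) →ₗ[R]
            SymmetricAlgebra R (SymmetricAlgebra R M))) :=
      SymmetricAlgebra.algHom_ext (LinearMap.ext fun x => by simp [symMap])
    exact SemimoduleCat.hom_ext (congrArg AlgHom.toLinearMap h)
  left_unit M := SemimoduleCat.hom_ext (LinearMap.ext fun x =>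
    SymmetricAlgebra.lift_ι_apply (LinearMap.id : _ →ₗ[R] SymmetricAlgebra R M) x)
  right_unit M := by
    have h : (SymmetricAlgebra.lift
          (LinearMap.id : SymmetricAlgebra R M →ₗ[R] SymmetricAlgebra R M)).comp
          (symMap R (SymmetricAlgebra.ι R M)) = AlgHom.id R _ :=
      SymmetricAlgebra.algHom_ext (LinearMap.ext fun x => by simp [symMap])
    exact SemimoduleCat.hom_ext (congrArg AlgHom.toLinearMap h)

/-- `Sym` as a comonad on the opposite of the category of `R`-modules. -/
abbrev symComonad : Comonad (SemimoduleCat.{u} R)ᵒᵖ := Monad.opComonad (symMonad R)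

variable (M N : SemimoduleCat.{u} R)

/-- Multiplication of the algebra `Sym M`. -/
def symMul : (symFunctor R).obj M ⊗ (symFunctor R).obj M ⟶ (symFunctor R).obj M :=
  SemimoduleCat.ofHom (LinearMap.mul' R (SymmetricAlgebra R M))

/-- Unit of the algebra `Sym M`. -/
def symUnit : 𝟙_ (SemimoduleCat.{u} R) ⟶ (symFunctor R).obj M :=
  SemimoduleCat.ofHom (Algebra.linearMap R (SymmetricAlgebra R M))

/-- The comonoidal structure `Sym (M ⊗ N) ⟶ Sym M ⊗ Sym N`: the algebra morphism with
`x ⊗ y ↦ x ⊗ y` on generators. -/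
def symComonoidal : (symFunctor R).obj (M ⊗ N) ⟶ (symFunctor R).obj M ⊗ (symFunctor R).obj N :=
  SemimoduleCat.ofHom (SymmetricAlgebra.lift
    (TensorProduct.map (SymmetricAlgebra.ι R M) (SymmetricAlgebra.ι R N))).toLinearMap

/-- The comonoidal structure `Sym R ⟶ R`: the algebra morphism which is the identity on the
generators. -/
def symComonoidalUnit : (symFunctor R).obj (𝟙_ (SemimoduleCat.{u} R)) ⟶ 𝟙_ (SemimoduleCat.{u} R) :=
  SemimoduleCat.ofHom (SymmetricAlgebra.lift (LinearMap.id : R →ₗ[R] R)).toLinearMap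

/-- The algebra morphism `a ↦ a + (d a) ε` into the square-zero extension, with
`x ↦ x + (1 ⊗ x) ε` for a generator `x`. -/
def symTaylor (M : Type u) [AddCommMonoid M] [Module R M] :
    SymmetricAlgebra R M →ₐ[R]
      TrivSqZeroExt (SymmetricAlgebra R M) (SymmetricAlgebra R M ⊗[R] M) :=
  SymmetricAlgebra.lift
    ((TrivSqZeroExt.inlAlgHom R (SymmetricAlgebra R M)
        (SymmetricAlgebra R M ⊗[R] M)).toLinearMap ∘ₗ SymmetricAlgebra.ι R M +
      (TrivSqZeroExt.inrHom (SymmetricAlgebra R M)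
        (SymmetricAlgebra R M ⊗[R] M)).restrictScalars R ∘ₗ
          TensorProduct.mk R (SymmetricAlgebra R M) M 1)

theorem symTaylor_fst (M : Type u) [AddCommMonoid M] [Module R M] (a : SymmetricAlgebra R M) :
    (symTaylor R M a).fst = a := by
  have h : (TrivSqZeroExt.fstHom R (SymmetricAlgebra R M) (SymmetricAlgebra R M ⊗[R] M)).comp
      (symTaylor R M) = AlgHom.id R _ :=
    SymmetricAlgebra.algHom_ext (LinearMap.ext fun x => by simp [symTaylor])
  exact congrArg (fun φ => φ a) h

/-- Polynomial differentiation `Sym M ⟶ Sym M ⊗ M`: the unique derivation with `d x = 1 ⊗ x` for a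
generator `x`, that is, `x₁ ⋯ xₙ ↦ ∑ i, (∏ j ≠ i, x_j) ⊗ x_i`. -/
def symDerivation (M : Type u) [AddCommMonoid M] [Module R M] :
    Derivation R (SymmetricAlgebra R M) (SymmetricAlgebra R M ⊗[R] M) where
  toFun a := (symTaylor R M a).snd
  map_add' a b := by simp
  map_smul' r a := by simp
  map_one_eq_zero' := by simp
  leibniz' a b := by simp [symTaylor_fst]

theorem symDerivation_ι (M : Type u) [AddCommMonoid M] [Module R M] (x : M) :
    symDerivation R M (SymmetricAlgebra.ι R M x) = 1 ⊗ₜ[R] x := by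
  change (symTaylor R M (SymmetricAlgebra.ι R M x)).snd = _
  simp [symTaylor]

/-- Polynomial differentiation as a morphism `Sym M ⟶ Sym M ⊗ M` of `R`-modules. -/
def symDeriving : (symFunctor R).obj M ⟶ (symFunctor R).obj M ⊗ M :=
  SemimoduleCat.ofHom (symDerivation R M).toLinearMap

/-- The algebra isomorphism `Sym R ≃ R[x]` sending the generator `1` to `x`. -/
def symEquivPolynomial : SymmetricAlgebra R R ≃ₐ[R] Polynomial R :=
  AlgEquiv.ofAlgHom
    (SymmetricAlgebra.lift (LinearMap.toSpanSingleton R (Polynomial R) Polynomial.X))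
    (Polynomial.aeval (SymmetricAlgebra.ι R R 1))
    (Polynomial.algHom_ext (by simp))
    (SymmetricAlgebra.algHom_ext (LinearMap.ext_ring (by simp)))

/-- A map `Sym R ⟶ Sym R` in the opposite category of `R`-modules, seen as a linear
endomorphism of `R[x]`. -/
def asPolynomialMap
    (f : (symComonad R).obj (𝟙_ (SemimoduleCat.{u} R)ᵒᵖ) ⟶
      (symComonad R).obj (𝟙_ (SemimoduleCat.{u} R)ᵒᵖ)) :
    Polynomial R →ₗ[R] Polynomial R :=
  (symEquivPolynomial R).toLinearMap ∘ₗ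
    (show SymmetricAlgebra R R →ₗ[R] SymmetricAlgebra R R from f.unop.hom) ∘ₗ
      (symEquivPolynomial R).symm.toLinearMap

end Sym

/-- Polynomial integration: `∑ rₖ xᵏ ↦ ∑ ((k+1)⁻¹ rₖ) xᵏ⁺¹`. -/
noncomputable def polynomialIntegral {R : Type u} [CommSemiring R]
    (hR : ∀ k : ℕ, 0 < k → IsUnit (k : R)) (p : Polynomial R) : Polynomial R :=
  p.sum fun k r => Polynomial.monomial (k + 1) (↑(hR (k + 1) k.succ_pos).unit⁻¹ * r)

/-!
Everything is an identity between linear maps out of tensor products of symmetric algebras, once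
the opposite category is unwound.

The coalgebra modality laws are the commutative algebra laws of `Sym M`, together with the fact that
`Sym f` and the monad multiplication `symJoin` are algebra morphisms. In the laws of the monoidal
structure all maps out of `Sym` are again algebra morphisms (`Sym M ⊗ Sym N` being the coproduct of
commutative algebras), hence are determined by their values on generators.

The constant, linear and Leibniz rules say that `d` is a derivation with `d x = 1 ⊗ x`. The other
laws of the deriving transformation are linear, so they may be checked on products `x₁ ⋯ xₙ` of
generators, which span `Sym M` (`genProd_ext`), by induction on `n`; the chain rule is
`symDerivation_join`, and the interchange rule `symDerivation_interchange` is the symmetry of the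
second derivative.

For the antiderivatives, `symRescale w` multiplies the part of degree `n` of `Sym M` by a weight
`w n : R`. No direct sum decomposition of `Sym M` is needed: the degree is recorded by the algebra
morphism `Sym M → (Sym M)[X]` with `x ↦ x X`, and the coefficients are then recombined. By Euler's
identity, `d` followed by multiplication is `symRescale` with weights `n`, while `Sym 0` is
`symRescale` with weights `1, 0, 0, …`. Hence `K` is `symRescale` with weights
`1, 1, 2, 3, …`, and it is inverted by rescaling with the inverse weights, which exist in `R` by
assumption. Subtraction is never used, so `R` may be a semiring. Over the unit, `ι 1 ^ k` has degree
`k`, so that the integral `K⁻¹ (ι 1 ^ k * ι 1)` is `(k + 1)⁻¹ • ι 1 ^ (k + 1)`.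
-/

noncomputable section

open SemimoduleCat.MonoidalCategory

variable (R : Type u) [CommSemiring R]

/-! ### The structure maps of `Sym` as algebra morphisms -/

section AlgebraMorphisms

variable (M N P : Type u) [AddCommMonoid M] [Module R M] [AddCommMonoid N] [Module R N]
  [AddCommMonoid P] [Module R P]

/-- The multiplication of the monad `Sym`, as an algebra morphism. -/
def symJoin : SymmetricAlgebra R (SymmetricAlgebra R M) →ₐ[R] SymmetricAlgebra R M :=
  SymmetricAlgebra.lift LinearMap.id

/-- The comonoidal structure of `Sym`, as an algebra morphism. -/
def symComult : SymmetricAlgebra R (M ⊗[R] N) →ₐ[R]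
    SymmetricAlgebra R M ⊗[R] SymmetricAlgebra R N :=
  SymmetricAlgebra.lift (TensorProduct.map (SymmetricAlgebra.ι R M) (SymmetricAlgebra.ι R N))

/-- The nullary comonoidal structure of `Sym`, as an algebra morphism. -/
def symCounit : SymmetricAlgebra R R →ₐ[R] R := SymmetricAlgebra.lift LinearMap.id

variable {M N P}

@[simp] theorem symMap_ι (f : M →ₗ[R] N) (x : M) :
    symMap R f (SymmetricAlgebra.ι R M x) = SymmetricAlgebra.ι R N (f x) :=
  SymmetricAlgebra.lift_ι_apply _ x

@[simp] theorem symJoin_ι (a : SymmetricAlgebra R M) :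
    symJoin R M (SymmetricAlgebra.ι R _ a) = a :=
  SymmetricAlgebra.lift_ι_apply _ a

@[simp] theorem symComult_ι_tmul (x : M) (y : N) :
    symComult R M N (SymmetricAlgebra.ι R _ (x ⊗ₜ y)) =
      SymmetricAlgebra.ι R M x ⊗ₜ SymmetricAlgebra.ι R N y :=
  SymmetricAlgebra.lift_ι_apply _ _

@[simp] theorem symCounit_ι (r : R) : symCounit R (SymmetricAlgebra.ι R R r) = r :=
  SymmetricAlgebra.lift_ι_apply _ r

theorem symComult_natural {M' N' : Type u} [AddCommMonoid M'] [Module R M'] [AddCommMonoid N']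
    [Module R N'] (f : M →ₗ[R] M') (g : N →ₗ[R] N') :
    (Algebra.TensorProduct.map (symMap R f) (symMap R g)).comp (symComult R M N) =
      (symComult R M' N').comp (symMap R (TensorProduct.map f g)) :=
  SymmetricAlgebra.algHom_ext (TensorProduct.ext' fun x y => by simp)

variable (M N P)

theorem symComult_assoc :
    ((Algebra.TensorProduct.map (symComult R M N) (AlgHom.id R (SymmetricAlgebra R P))).comp
        (symComult R (M ⊗[R] N) P)).comp
          (symMap R (TensorProduct.assoc R M N P).symm.toLinearMap) =
      (Algebra.TensorProduct.assoc R R R (SymmetricAlgebra R M) (SymmetricAlgebra R N)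
          (SymmetricAlgebra R P)).symm.toAlgHom.comp
        ((Algebra.TensorProduct.map (AlgHom.id R (SymmetricAlgebra R M)) (symComult R N P)).comp
          (symComult R M (N ⊗[R] P))) := by
  -- `A` is given because unification does not recover its commutative semiring structure
  refine SymmetricAlgebra.algHom_ext (A := (SymmetricAlgebra R M ⊗[R] SymmetricAlgebra R N) ⊗[R]
    SymmetricAlgebra R P) ?_
  exact TensorProduct.ext_threefold' fun x y z => by simp

theorem symComult_counit_left :
    ((Algebra.TensorProduct.map (symCounit R) (AlgHom.id R (SymmetricAlgebra R M))).comp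
        (symComult R R M)).comp (symMap R (TensorProduct.lid R M).symm.toLinearMap) =
      (Algebra.TensorProduct.lid R (SymmetricAlgebra R M)).symm.toAlgHom :=
  SymmetricAlgebra.algHom_ext (LinearMap.ext fun x => by simp)

theorem symComult_counit_right :
    ((Algebra.TensorProduct.map (AlgHom.id R (SymmetricAlgebra R M)) (symCounit R)).comp
        (symComult R M R)).comp (symMap R (TensorProduct.rid R M).symm.toLinearMap) =
      (Algebra.TensorProduct.rid R R (SymmetricAlgebra R M)).symm.toAlgHom :=
  SymmetricAlgebra.algHom_ext (LinearMap.ext fun x => by simp)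

theorem symComult_comm :
    (Algebra.TensorProduct.comm R (SymmetricAlgebra R N) (SymmetricAlgebra R M)).toAlgHom.comp
        (symComult R N M) =
      (symComult R M N).comp (symMap R (TensorProduct.comm R N M).toLinearMap) :=
  SymmetricAlgebra.algHom_ext (TensorProduct.ext' fun x y => by simp)

/-- The comonoidal structure is compatible with the monad multiplication. -/
theorem symComult_join :
    (symComult R M N).comp (symJoin R (M ⊗[R] N)) =
      (Algebra.TensorProduct.map (symJoin R M) (symJoin R N)).comp
        ((symComult R (SymmetricAlgebra R M) (SymmetricAlgebra R N)).comp
          (symMap R (symComult R M N).toLinearMap)) := by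
  have h (z : SymmetricAlgebra R M ⊗[R] SymmetricAlgebra R N) :
      Algebra.TensorProduct.map (symJoin R M) (symJoin R N)
        (symComult R (SymmetricAlgebra R M) (SymmetricAlgebra R N) (SymmetricAlgebra.ι R _ z)) =
          z := by
    induction z with
    | zero => simp
    | tmul a b => simp
    | add z w hz hw => simp only [map_add, hz, hw]
  exact SymmetricAlgebra.algHom_ext (LinearMap.ext fun x => by simp [h])

theorem symCounit_join :
    (symCounit R).comp (symJoin R R) = (symCounit R).comp (symMap R (symCounit R).toLinearMap) :=
  SymmetricAlgebra.algHom_ext (LinearMap.ext fun x => by simp)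

theorem symJoin_map_mul :
    (symJoin R M).comp (symMap R (LinearMap.mul' R (SymmetricAlgebra R M))) =
      ((Algebra.TensorProduct.lmul' R).comp
        (Algebra.TensorProduct.map (symJoin R M) (symJoin R M))).comp
          (symComult R (SymmetricAlgebra R M) (SymmetricAlgebra R M)) :=
  SymmetricAlgebra.algHom_ext (TensorProduct.ext' fun x y => by simp)

theorem symJoin_map_algebraMap :
    (symJoin R M).comp (symMap R (Algebra.linearMap R (SymmetricAlgebra R M))) =
      (Algebra.ofId R (SymmetricAlgebra R M)).comp (symCounit R) :=
  SymmetricAlgebra.algHom_ext (LinearMap.ext fun x => by simp [Algebra.ofId_apply])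

theorem mul'_tensorProduct (A B : Type u) [CommSemiring A] [CommSemiring B] [Algebra R A]
    [Algebra R B] :
    LinearMap.mul' R (A ⊗[R] B) =
      TensorProduct.map (LinearMap.mul' R A) (LinearMap.mul' R B) ∘ₗ
        (TensorProduct.tensorTensorTensorComm R A B A B).toLinearMap := by
  refine TensorProduct.ext (TensorProduct.ext' fun a b => TensorProduct.ext' fun a' b' => ?_)
  simp

end AlgebraMorphisms

/-! ### The monoidal coalgebra modality -/

theorem unop_tensorμ_eq_tensorTensorTensorComm (A A' B B' : (SemimoduleCat.{u} R)ᵒᵖ) :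
    (tensorμ A A' B B').unop = SemimoduleCat.ofHom
      (TensorProduct.tensorTensorTensorComm R A.unop B.unop A'.unop B'.unop).toLinearMap :=
  (BraidedCategory.unop_tensorμ A B A' B').trans tensorμ_eq_tensorTensorTensorComm

/-- The coalgebra modality on the comonad `Sym`, given by the multiplication and the unit of the
algebras `Sym M`. -/
def symCoalgebraModality : CoalgebraModality (symComonad R) where
  Δ A := (symMul R A.unop).op
  e A := (symUnit R A.unop).op
  Δ_natural f := Quiver.Hom.unop_inj <| tensor_ext fun (a b : SymmetricAlgebra R _) =>
    map_mul (symMap R f.unop.hom) a b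
  e_natural f := Quiver.Hom.unop_inj <| SemimoduleCat.hom_ext <| LinearMap.ext fun r =>
    (symMap R f.unop.hom).commutes r
  coassoc A := Quiver.Hom.unop_inj <| tensor_ext₃ fun (a b c : SymmetricAlgebra R A.unop) =>
    show a * b * c = a * (b * c) from mul_assoc a b c
  counit_left A := Quiver.Hom.unop_inj <| SemimoduleCat.hom_ext <| LinearMap.ext
    fun (a : SymmetricAlgebra R A.unop) =>
      show algebraMap R (SymmetricAlgebra R A.unop) 1 * a = a by simp
  counit_right A := Quiver.Hom.unop_inj <| SemimoduleCat.hom_ext <| LinearMap.ext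
    fun (a : SymmetricAlgebra R A.unop) =>
      show a * algebraMap R (SymmetricAlgebra R A.unop) 1 = a by simp
  cocomm A := Quiver.Hom.unop_inj <| tensor_ext fun (a b : SymmetricAlgebra R A.unop) =>
    mul_comm b a
  ρ_Δ A := Quiver.Hom.unop_inj <| tensor_ext fun (a b : SymmetricAlgebra R _) =>
    (map_mul (symJoin R A.unop) a b).symm
  ρ_e A := Quiver.Hom.unop_inj <| SemimoduleCat.hom_ext <| LinearMap.ext fun r =>
    (symJoin R A.unop).commutes r

/-- The monoidal coalgebra modality on the comonad `Sym`. -/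
def symMonoidalCoalgebraModality : MonoidalCoalgebraModality (symComonad R) where
  toCoalgebraModality := symCoalgebraModality R
  m A B := (symComonoidal R A.unop B.unop).op
  mUnit := (symComonoidalUnit R).op
  m_natural f g := Quiver.Hom.unop_inj <| SemimoduleCat.hom_ext <|
    congrArg AlgHom.toLinearMap (symComult_natural R f.unop.hom g.unop.hom)
  m_assoc A B D := Quiver.Hom.unop_inj <| SemimoduleCat.hom_ext <|
    congrArg AlgHom.toLinearMap (symComult_assoc R A.unop B.unop D.unop)
  m_unit_left A := Quiver.Hom.unop_inj <| SemimoduleCat.hom_ext <|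
    congrArg AlgHom.toLinearMap (symComult_counit_left R A.unop)
  m_unit_right A := Quiver.Hom.unop_inj <| SemimoduleCat.hom_ext <|
    congrArg AlgHom.toLinearMap (symComult_counit_right R A.unop)
  m_symm A B := Quiver.Hom.unop_inj <| SemimoduleCat.hom_ext <|
    congrArg AlgHom.toLinearMap (symComult_comm R A.unop B.unop)
  m_ρ A B := Quiver.Hom.unop_inj <| SemimoduleCat.hom_ext <|
    congrArg AlgHom.toLinearMap (symComult_join R A.unop B.unop)
  m_ε A B := Quiver.Hom.unop_inj <| SemimoduleCat.hom_ext <|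
    SymmetricAlgebra.lift_comp_ι (TensorProduct.map (SymmetricAlgebra.ι R A.unop)
      (SymmetricAlgebra.ι R B.unop))
  mUnit_ρ := Quiver.Hom.unop_inj <| SemimoduleCat.hom_ext <|
    congrArg AlgHom.toLinearMap (symCounit_join R)
  mUnit_ε := Quiver.Hom.unop_inj <| SemimoduleCat.hom_ext <|
    SymmetricAlgebra.lift_comp_ι (LinearMap.id : R →ₗ[R] R)
  m_Δ A B := Quiver.Hom.unop_inj <| by
    refine tensor_ext fun (a b : SymmetricAlgebra R _) => ?_
    refine (map_mul (symComult R A.unop B.unop) a b).trans ?_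
    refine (LinearMap.congr_fun (mul'_tensorProduct R (SymmetricAlgebra R A.unop)
      (SymmetricAlgebra R B.unop))
        (symComult R A.unop B.unop a ⊗ₜ symComult R A.unop B.unop b)).trans ?_
    exact congrArg (TensorProduct.map (LinearMap.mul' R (SymmetricAlgebra R A.unop))
      (LinearMap.mul' R (SymmetricAlgebra R B.unop)))
        (congrArg (fun φ => φ.hom (symComult R A.unop B.unop a ⊗ₜ symComult R A.unop B.unop b))
          (unop_tensorμ_eq_tensorTensorTensorComm R ((symComonad R).obj A) ((symComonad R).obj A)
            ((symComonad R).obj B) ((symComonad R).obj B))).symm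
  m_e A B := Quiver.Hom.unop_inj <| SemimoduleCat.hom_ext <| LinearMap.ext fun r =>
    ((symComult R A.unop B.unop).commutes r).trans
      (Algebra.TensorProduct.algebraMap_apply' r)
  mUnit_Δ := Quiver.Hom.unop_inj <| tensor_ext fun (a b : SymmetricAlgebra R R) =>
    map_mul (symCounit R) a b
  mUnit_e := Quiver.Hom.unop_inj <| SemimoduleCat.hom_ext <| LinearMap.ext fun r =>
    show symCounit R (algebraMap R _ r) = r by simp
  ρ_map_Δ A := Quiver.Hom.unop_inj <| SemimoduleCat.hom_ext <|
    congrArg AlgHom.toLinearMap (symJoin_map_mul R A.unop)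
  ρ_map_e A := Quiver.Hom.unop_inj <| SemimoduleCat.hom_ext <|
    congrArg AlgHom.toLinearMap (symJoin_map_algebraMap R A.unop)

/-! ### Products of generators -/

section Derivation

variable {M N P : Type u} [AddCommMonoid M] [Module R M] [AddCommMonoid N] [Module R N]
  [AddCommMonoid P] [Module R P]

/-- The product `x₁ ⋯ xₙ` in `Sym M` of a list of generators. -/
def genProd (l : List M) : SymmetricAlgebra R M := (l.map (SymmetricAlgebra.ι R M)).prod

theorem span_range_genProd : Submodule.span R (Set.range (genProd R (M := M))) = ⊤ := by
  refine eq_top_iff.2 fun a _ => ?_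
  induction a using SymmetricAlgebra.induction with
  | algebraMap r =>
    rw [Algebra.algebraMap_eq_smul_one]
    exact Submodule.smul_mem _ r (Submodule.subset_span ⟨[], by simp [genProd]⟩)
  | ι x => exact Submodule.subset_span ⟨[x], by simp [genProd]⟩
  | mul a b ha hb =>
    have h := Submodule.mul_mem_mul (ha trivial) (hb trivial)
    rw [Submodule.span_mul_span] at h
    refine Submodule.span_mono ?_ h
    rintro _ ⟨_, ⟨l, rfl⟩, _, ⟨l', rfl⟩, rfl⟩
    exact ⟨l ++ l', by simp [genProd]⟩
  | add a b ha hb => exact add_mem (ha trivial) (hb trivial)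

variable {R} in
/-- Linear maps out of `Sym M` are determined by their values on products of generators. -/
theorem genProd_ext {f g : SymmetricAlgebra R M →ₗ[R] P}
    (h : ∀ l : List M, f (genProd R l) = g (genProd R l)) : f = g :=
  LinearMap.ext_on_range (span_range_genProd R) h

@[simp] theorem genProd_nil : genProd R ([] : List M) = 1 := rfl
@[simp] theorem genProd_cons (x : M) (l : List M) :
    genProd R (x :: l) = SymmetricAlgebra.ι R M x * genProd R l := by simp [genProd]

/-! ### The deriving transformation -/

theorem map_symMap_smul (f : M →ₗ[R] N) (a : SymmetricAlgebra R M)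
    (w : SymmetricAlgebra R M ⊗[R] M) :
    TensorProduct.map (symMap R f).toLinearMap f (a • w) =
      symMap R f a • TensorProduct.map (symMap R f).toLinearMap f w := by
  induction w with
  | zero => simp
  | tmul b x => simp [TensorProduct.smul_tmul']
  | add w z hw hz => simp only [smul_add, map_add, hw, hz]

/-- Naturality of polynomial differentiation. -/
theorem map_symDerivation (f : M →ₗ[R] N) :
    TensorProduct.map (symMap R f).toLinearMap f ∘ₗ (symDerivation R M).toLinearMap =
      (symDerivation R N).toLinearMap ∘ₗ (symMap R f).toLinearMap := by
  refine genProd_ext fun l => ?_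
  simp only [LinearMap.comp_apply, AlgHom.toLinearMap_apply, Derivation.coeFn_coe]
  induction l with
  | nil => simp
  | cons x l ih =>
    simp only [genProd_cons, Derivation.leibniz, map_add, map_symMap_smul, ih, map_mul,
      symDerivation_ι, symMap_ι, TensorProduct.map_tmul, AlgHom.toLinearMap_apply, map_one]

/-- The action of `A` on `A ⊗ M` as a linear map, written through the associator as it occurs in
the Leibniz and chain rules. -/
def tensorSMul (A M : Type u) [CommSemiring A] [Algebra R A] [AddCommMonoid M] [Module R M] :
    A ⊗[R] (A ⊗[R] M) →ₗ[R] A ⊗[R] M :=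
  (LinearMap.mul' R A).rTensor M ∘ₗ (TensorProduct.assoc R A A M).symm.toLinearMap

@[simp] theorem tensorSMul_tmul (A M : Type u) [CommSemiring A] [Algebra R A] [AddCommMonoid M]
    [Module R M] (a : A) (w : A ⊗[R] M) : tensorSMul R A M (a ⊗ₜ w) = a • w := by
  induction w with
  | zero => simp
  | tmul b x => simp [tensorSMul, TensorProduct.smul_tmul']
  | add w z hw hz => simp only [smul_add, TensorProduct.tmul_add, map_add, hw, hz]

/-- The action of `A` on `A ⊗ M` from the right, as it occurs in the Leibniz rule. -/
theorem tensorSMul_comm_tmul (A M : Type u) [CommSemiring A] [Algebra R A] [AddCommMonoid M]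
    [Module R M] (w : A ⊗[R] M) (a : A) :
    (LinearMap.mul' R A).rTensor M ((TensorProduct.assoc R A A M).symm
      ((TensorProduct.comm R M A).toLinearMap.lTensor A (TensorProduct.assoc R A M A (w ⊗ₜ a)))) =
        a • w := by
  induction w with
  | zero => simp
  | tmul b x => simp [TensorProduct.smul_tmul', mul_comm]
  | add w z hw hz => simp only [smul_add, TensorProduct.add_tmul, map_add, hw, hz]

/-- The second factor of the chain rule is linear along `symJoin`. -/
theorem tensorSMul_map_smul (F : SymmetricAlgebra R (SymmetricAlgebra R M))
    (w : SymmetricAlgebra R (SymmetricAlgebra R M) ⊗[R] SymmetricAlgebra R M) :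
    tensorSMul R (SymmetricAlgebra R M) M (TensorProduct.map (symJoin R M).toLinearMap
        (symDerivation R M).toLinearMap (F • w)) =
      symJoin R M F • tensorSMul R (SymmetricAlgebra R M) M
        (TensorProduct.map (symJoin R M).toLinearMap (symDerivation R M).toLinearMap w) := by
  induction w with
  | zero => simp
  | tmul b x => simp [TensorProduct.smul_tmul', mul_smul]
  | add w z hw hz => simp only [smul_add, map_add, hw, hz]

/-- The chain rule. -/
theorem symDerivation_join :
    (symDerivation R M).toLinearMap ∘ₗ (symJoin R M).toLinearMap =
      tensorSMul R (SymmetricAlgebra R M) M ∘ₗ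
        TensorProduct.map (symJoin R M).toLinearMap (symDerivation R M).toLinearMap ∘ₗ
          (symDerivation R (SymmetricAlgebra R M)).toLinearMap := by
  refine genProd_ext fun l => ?_
  simp only [LinearMap.comp_apply, AlgHom.toLinearMap_apply, Derivation.coeFn_coe]
  induction l with
  | nil => simp
  | cons x l ih =>
    simp only [genProd_cons, Derivation.leibniz, map_add, map_mul, symJoin_ι, tensorSMul_map_smul,
      ih, symDerivation_ι, TensorProduct.map_tmul, AlgHom.toLinearMap_apply, map_one,
      tensorSMul_tmul, Derivation.coeFn_coe, one_smul]

/-- The exchange of the last two factors of `(A ⊗ M) ⊗ M`. -/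
def swapLast (A M : Type u) [CommSemiring A] [Algebra R A] [AddCommMonoid M] [Module R M] :
    (A ⊗[R] M) ⊗[R] M →ₗ[R] (A ⊗[R] M) ⊗[R] M :=
  (TensorProduct.assoc R A M M).symm.toLinearMap ∘ₗ
    (TensorProduct.comm R M M).toLinearMap.lTensor A ∘ₗ (TensorProduct.assoc R A M M).toLinearMap

@[simp] theorem swapLast_tmul (A M : Type u) [CommSemiring A] [Algebra R A] [AddCommMonoid M]
    [Module R M] (a : A) (x y : M) :
    swapLast R A M ((a ⊗ₜ x) ⊗ₜ y) = (a ⊗ₜ y) ⊗ₜ x := rfl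

theorem swapLast_smul (A M : Type u) [CommSemiring A] [Algebra R A] [AddCommMonoid M] [Module R M]
    (a : A) (z : (A ⊗[R] M) ⊗[R] M) : swapLast R A M (a • z) = a • swapLast R A M z := by
  induction z with
  | zero => simp
  | tmul w y =>
    induction w with
    | zero => simp
    | tmul b x => simp [TensorProduct.smul_tmul']
    | add w z hw hz => simp only [smul_add, TensorProduct.add_tmul, map_add, hw, hz]
  | add w z hw hz => simp only [smul_add, map_add, hw, hz]

theorem swapLast_swapLast (A M : Type u) [CommSemiring A] [Algebra R A] [AddCommMonoid M]
    [Module R M] (z : (A ⊗[R] M) ⊗[R] M) : swapLast R A M (swapLast R A M z) = z := by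
  simp [swapLast, ← LinearMap.lTensor_comp_apply]

/-- The Leibniz rule for `d ⊗ 1` with a generator as first factor. -/
theorem rTensor_symDerivation_ι_smul (x : M) (w : SymmetricAlgebra R M ⊗[R] M) :
    (symDerivation R M).toLinearMap.rTensor M (SymmetricAlgebra.ι R M x • w) =
      SymmetricAlgebra.ι R M x • (symDerivation R M).toLinearMap.rTensor M w +
        swapLast R (SymmetricAlgebra R M) M (w ⊗ₜ x) := by
  induction w with
  | zero => simp
  | tmul b y =>
    simp [TensorProduct.smul_tmul', symDerivation_ι, TensorProduct.add_tmul]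
  | add w z hw hz =>
    simp only [smul_add, map_add, hw, hz, TensorProduct.add_tmul]
    abel

/-- The interchange rule: the second derivative is symmetric. -/
theorem symDerivation_interchange :
    (symDerivation R M).toLinearMap.rTensor M ∘ₗ (symDerivation R M).toLinearMap =
      swapLast R (SymmetricAlgebra R M) M ∘ₗ
        (symDerivation R M).toLinearMap.rTensor M ∘ₗ (symDerivation R M).toLinearMap := by
  refine genProd_ext fun l => ?_
  simp only [LinearMap.comp_apply]
  induction l with
  | nil => simp
  | cons x l ih =>
    have h : (symDerivation R M).toLinearMap (genProd R (x :: l)) =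
        SymmetricAlgebra.ι R M x • (symDerivation R M).toLinearMap (genProd R l) +
          genProd R l ⊗ₜ x := by
      simp [symDerivation_ι, TensorProduct.smul_tmul']
    -- the two mixed terms `d l ⊗ x` and its swap are exchanged, and the rest is symmetric by `ih`
    rw [h, map_add, rTensor_symDerivation_ι_smul, LinearMap.rTensor_tmul, map_add, map_add,
      swapLast_smul, ← ih, swapLast_swapLast, add_assoc, add_assoc, add_comm (swapLast _ _ _ _)]

end Derivation

/-- Polynomial differentiation as a deriving transformation. -/
def symDerivingTransformation : DerivingTransformation (symCoalgebraModality R) where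
  d A := (symDeriving R A.unop).op
  d_natural f := Quiver.Hom.unop_inj <| SemimoduleCat.hom_ext <|
    map_symDerivation R f.unop.hom
  constant_rule A := Quiver.Hom.unop_inj <| SemimoduleCat.hom_ext <| LinearMap.ext fun r =>
    (symDerivation R A.unop).map_algebraMap r
  leibniz_rule A := Quiver.Hom.unop_inj <|
    tensor_ext fun (a b : SymmetricAlgebra R A.unop) =>
      ((symDerivation R A.unop).leibniz a b).trans <| (add_comm _ _).trans <| congrArg₂ (· + ·)
        (tensorSMul_comm_tmul R _ _ _ _).symm (tensorSMul_tmul R _ _ _ _).symm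
  linear_rule A := Quiver.Hom.unop_inj <| SemimoduleCat.hom_ext <| LinearMap.ext fun x =>
    (symDerivation_ι R A.unop x).trans
      (congrArg (· ⊗ₜ[R] x) (map_one (algebraMap R (SymmetricAlgebra R A.unop))).symm)
  chain_rule _ := Quiver.Hom.unop_inj <| SemimoduleCat.hom_ext <| symDerivation_join R
  interchange_rule _ := Quiver.Hom.unop_inj <| SemimoduleCat.hom_ext <|
    symDerivation_interchange R

/-- The differential linear structure on the comonad `Sym`. -/
def symDifferentialLinearStructure : DifferentialLinearStructure (symComonad R) where
  toMonoidalCoalgebraModality := symMonoidalCoalgebraModality R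
  deriving_ := symDerivingTransformation R

/-! ### Rescaling by the degree -/

section Rescale

variable (M : Type u) [AddCommMonoid M] [Module R M]

/-- The algebra morphism `Sym M → (Sym M)[X]` with `x ↦ x X` for a generator `x`: the coefficient
of `X ^ n` is the component of degree `n`. -/
def symDegreeHom : SymmetricAlgebra R M →ₐ[R] Polynomial (SymmetricAlgebra R M) :=
  SymmetricAlgebra.lift ((Polynomial.monomial 1).restrictScalars R ∘ₗ SymmetricAlgebra.ι R M)

/-- The linear endomorphism of `Sym M` that multiplies the component of degree `n` by `w n`. -/
def symRescale (w : ℕ → R) : SymmetricAlgebra R M →ₗ[R] SymmetricAlgebra R M :=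
  Polynomial.lsum (fun n => w n • LinearMap.id) ∘ₗ (symDegreeHom R M).toLinearMap

variable {M}

theorem symDegreeHom_genProd (l : List M) :
    symDegreeHom R M (genProd R l) = Polynomial.monomial l.length (genProd R l) := by
  induction l with
  | nil => simp
  | cons x l ih =>
    have h : symDegreeHom R M (SymmetricAlgebra.ι R M x) =
        Polynomial.monomial 1 (SymmetricAlgebra.ι R M x) := SymmetricAlgebra.lift_ι_apply _ x
    rw [genProd_cons, map_mul, ih, h, Polynomial.monomial_mul_monomial, List.length_cons,
      add_comm]

theorem symRescale_genProd (w : ℕ → R) (l : List M) :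
    symRescale R M w (genProd R l) = w l.length • genProd R l := by
  simp [symRescale, symDegreeHom_genProd, Polynomial.lsum_apply, Polynomial.sum_monomial_index]

theorem symRescale_comp (w w' : ℕ → R) :
    symRescale R M w ∘ₗ symRescale R M w' = symRescale R M (w * w') :=
  genProd_ext fun l => by simp [symRescale_genProd, smul_smul, mul_comm]

theorem symRescale_one : symRescale R M 1 = LinearMap.id :=
  genProd_ext fun l => by simp [symRescale_genProd]

variable (M) in
/-- The coderiving transformation read on modules: `a ⊗ x ↦ a x`. -/
def symMulGen : SymmetricAlgebra R M ⊗[R] M →ₗ[R] SymmetricAlgebra R M :=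
  LinearMap.mul' R (SymmetricAlgebra R M) ∘ₗ (SymmetricAlgebra.ι R M).lTensor _

@[simp] theorem symMulGen_tmul (a : SymmetricAlgebra R M) (x : M) :
    symMulGen R M (a ⊗ₜ x) = a * SymmetricAlgebra.ι R M x := by simp [symMulGen]

theorem symMulGen_smul (a : SymmetricAlgebra R M) (w : SymmetricAlgebra R M ⊗[R] M) :
    symMulGen R M (a • w) = a * symMulGen R M w := by
  induction w with
  | zero => simp
  | tmul b x => simp [TensorProduct.smul_tmul', mul_assoc]
  | add w z hw hz => simp only [smul_add, map_add, hw, hz, mul_add]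

/-- Euler's identity: `d` followed by multiplication multiplies the degree `n` part by `n`. -/
theorem symMulGen_comp_symDerivation :
    symMulGen R M ∘ₗ (symDerivation R M).toLinearMap = symRescale R M (fun n => n) := by
  refine genProd_ext fun l => ?_
  rw [symRescale_genProd]
  induction l with
  | nil => simp
  | cons x l ih =>
    simp only [LinearMap.comp_apply, Derivation.coeFn_coe] at ih
    simp [symMulGen_smul, symDerivation_ι, ih, add_smul, mul_comm, add_comm]

theorem symMap_zero : (symMap R (0 : M →ₗ[R] M)).toLinearMap = symRescale R M (Pi.single 0 1) := by
  refine genProd_ext fun l => ?_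
  rw [symRescale_genProd]
  cases l <;> simp

theorem symRescale_add (w w' : ℕ → R) :
    symRescale R M w + symRescale R M w' = symRescale R M (w + w') :=
  genProd_ext fun l => by simp [symRescale_genProd, add_smul]

end Rescale

/-! ### Antiderivatives -/

section Antiderivatives

variable {R}

/-- The inverses of the weights `1, 1, 2, 3, …` by which `K` rescales. -/
def invWeight (hR : ∀ k : ℕ, 0 < k → IsUnit (k : R)) (n : ℕ) : R :=
  if h : 0 < n then ↑(hR n h).unit⁻¹ else 1

variable (hR : ∀ k : ℕ, 0 < k → IsUnit (k : R))

theorem invWeight_succ (n : ℕ) : invWeight hR (n + 1) = ↑(hR (n + 1) n.succ_pos).unit⁻¹ :=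
  dif_pos n.succ_pos

theorem invWeight_mul : invWeight hR * ((fun n : ℕ => (n : R)) + Pi.single 0 1) = 1 := by
  funext n
  cases n with
  | zero => simp [invWeight]
  | succ n => simp [invWeight_succ]

/-- The identity of weights behind the Second Fundamental Theorem of Calculus. -/
theorem invWeight_mul_add :
    invWeight hR * (fun n : ℕ => (n : R)) + Pi.single 0 1 = 1 := by
  funext n
  cases n with
  | zero => simp [invWeight]
  | succ n => simp [invWeight_succ]

/-- `K` multiplies the component of degree `n` by `n`, and that of degree `0` by `1`. -/
theorem symK_app (A : (SemimoduleCat.{u} R)ᵒᵖ) :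
    (symDifferentialLinearStructure R).K.app A =
      (SemimoduleCat.ofHom (symRescale R A.unop ((fun n : ℕ => (n : R)) + Pi.single 0 1))).op := by
  refine Quiver.Hom.unop_inj <| SemimoduleCat.hom_ext ?_
  rw [← symRescale_add, ← symMap_zero, ← symMulGen_comp_symDerivation]
  rfl

theorem symK_app_comp (A : (SemimoduleCat.{u} R)ᵒᵖ) :
    (symDifferentialLinearStructure R).K.app A ≫
      (SemimoduleCat.ofHom (symRescale R A.unop (invWeight hR))).op = 𝟙 _ := by
  rw [symK_app]
  refine Quiver.Hom.unop_inj <| SemimoduleCat.hom_ext ?_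
  refine (symRescale_comp R _ _).trans ?_
  rw [mul_comm, invWeight_mul]
  exact symRescale_one R

theorem comp_symK_app (A : (SemimoduleCat.{u} R)ᵒᵖ) :
    (SemimoduleCat.ofHom (symRescale R A.unop (invWeight hR))).op ≫
      (symDifferentialLinearStructure R).K.app A = 𝟙 _ := by
  rw [symK_app]
  refine Quiver.Hom.unop_inj <| SemimoduleCat.hom_ext ?_
  refine (symRescale_comp R _ _).trans ?_
  rw [invWeight_mul]
  exact symRescale_one R

theorem symHasAntiderivatives (hR : ∀ k : ℕ, 0 < k → IsUnit (k : R)) :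
    (symDifferentialLinearStructure R).HasAntiderivatives :=
  have (A : (SemimoduleCat.{u} R)ᵒᵖ) : IsIso ((symDifferentialLinearStructure R).K.app A) :=
    ⟨_, symK_app_comp hR A, comp_symK_app hR A⟩
  NatIso.isIso_of_isIso_app _

/-- The integral transformation read on modules: multiply by the generator, then divide by the
degree. -/
theorem symIntegral (h : (symDifferentialLinearStructure R).HasAntiderivatives)
    (A : (SemimoduleCat.{u} R)ᵒᵖ) :
    (symDifferentialLinearStructure R).integral h A =
      (SemimoduleCat.ofHom (symRescale R A.unop (invWeight hR) ∘ₗ symMulGen R A.unop)).op := by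
  have : IsIso (symDifferentialLinearStructure R).K := h
  have e : (inv (symDifferentialLinearStructure R).K).app A =
      (SemimoduleCat.ofHom (symRescale R A.unop (invWeight hR))).op := by
    rw [NatIso.isIso_inv_app]
    exact IsIso.inv_eq_of_hom_inv_id (symK_app_comp hR A)
  exact congrArg (· ≫ (symDifferentialLinearStructure R).coderiving A) e

theorem symIntegralUnit (h : (symDifferentialLinearStructure R).HasAntiderivatives) :
    (symDifferentialLinearStructure R).integralUnit h =
      (SemimoduleCat.ofHom (symRescale R R (invWeight hR) ∘ₗ symMulGen R R ∘ₗ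
        (TensorProduct.rid R (SymmetricAlgebra R R)).symm.toLinearMap)).op :=
  congrArg (· ≫ (ρ_ ((symComonad R).obj (𝟙_ _))).hom) (symIntegral hR h (𝟙_ _))

theorem symSatisfiesFTC2 (hR : ∀ k : ℕ, 0 < k → IsUnit (k : R))
    (h : (symDifferentialLinearStructure R).HasAntiderivatives) :
    (symDifferentialLinearStructure R).SatisfiesFTC2
      ((symDifferentialLinearStructure R).integralUnit h) := by
  rw [DifferentialLinearStructure.SatisfiesFTC2, symIntegralUnit hR]
  refine Quiver.Hom.unop_inj <| SemimoduleCat.hom_ext ?_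
  have e : symRescale R R (invWeight hR) ∘ₗ symMulGen R R ∘ₗ (symDerivation R R).toLinearMap +
      (symMap R (0 : R →ₗ[R] R)).toLinearMap = LinearMap.id := by
    rw [symMulGen_comp_symDerivation, symMap_zero, symRescale_comp, symRescale_add,
      invWeight_mul_add, symRescale_one]
  refine Eq.trans ?_ e
  -- the isomorphism `Sym R ⊗ R ≃ Sym R` and its inverse cancel between derivative and integral
  change (symRescale R R (invWeight hR) ∘ₗ symMulGen R R ∘ₗ
        (TensorProduct.rid R (SymmetricAlgebra R R)).symm.toLinearMap) ∘ₗ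
      ((TensorProduct.rid R (SymmetricAlgebra R R)).toLinearMap ∘ₗ
        (symDerivation R R).toLinearMap) + (symMap R (0 : R →ₗ[R] R)).toLinearMap = _
  congr 1
  ext a
  simp

/-! ### Polynomials in one variable -/

theorem symEquivPolynomial_symm_monomial (k : ℕ) (r : R) :
    (symEquivPolynomial R).symm (Polynomial.monomial k r) = r • SymmetricAlgebra.ι R R 1 ^ k := by
  change Polynomial.aeval _ _ = _
  rw [Polynomial.aeval_monomial, Algebra.smul_def]

theorem symEquivPolynomial_smul_ι_pow (k : ℕ) (r : R) :
    symEquivPolynomial R (r • SymmetricAlgebra.ι R R 1 ^ k) = Polynomial.monomial k r := by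
  rw [← symEquivPolynomial_symm_monomial, AlgEquiv.apply_symm_apply]

theorem ι_pow_eq_genProd (k : ℕ) :
    SymmetricAlgebra.ι R R 1 ^ k = genProd R (List.replicate k 1) := by simp [genProd]

theorem asPolynomialMap_dUnit (p : Polynomial R) :
    asPolynomialMap R (symDifferentialLinearStructure R).dUnit p = Polynomial.derivative p := by
  induction p using Polynomial.induction_on' with
  | add p q hp hq => rw [map_add, map_add, hp, hq]
  | monomial k r =>
    change symEquivPolynomial R (TensorProduct.rid R _ (symDerivation R R
      ((symEquivPolynomial R).symm (Polynomial.monomial k r)))) = _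
    rw [symEquivPolynomial_symm_monomial, Derivation.map_smul, Derivation.leibniz_pow,
      symDerivation_ι, Polynomial.derivative_monomial, ← symEquivPolynomial_smul_ι_pow]
    simp [TensorProduct.smul_tmul', mul_smul, ← Nat.cast_smul_eq_nsmul R]

theorem asPolynomialMap_integralUnit (h : (symDifferentialLinearStructure R).HasAntiderivatives)
    (p : Polynomial R) :
    asPolynomialMap R ((symDifferentialLinearStructure R).integralUnit h) p =
      polynomialIntegral hR p := by
  rw [symIntegralUnit hR]
  induction p using Polynomial.induction_on' with
  | add p q hp hq =>
    rw [map_add, hp, hq, polynomialIntegral, polynomialIntegral, polynomialIntegral,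
      Polynomial.sum_add_index] <;> simp [mul_add]
  | monomial k r =>
    change symEquivPolynomial R (symRescale R R (invWeight hR) (symMulGen R R
      ((symEquivPolynomial R).symm (Polynomial.monomial k r) ⊗ₜ 1))) = _
    rw [symEquivPolynomial_symm_monomial, polynomialIntegral, Polynomial.sum_monomial_index _ _
      (by simp), symMulGen_tmul, smul_mul_assoc, ← pow_succ, map_smul, ι_pow_eq_genProd,
      symRescale_genProd, ← ι_pow_eq_genProd, List.length_replicate, smul_smul,
      symEquivPolynomial_smul_ι_pow, invWeight_succ, mul_comm]

end Antiderivatives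

end

theorem mainTheorem5 (R : Type u) [CommSemiring R] (hR : ∀ k : ℕ, 0 < k → IsUnit (k : R)) :
    ∃ D : DifferentialLinearStructure (symComonad R),
      -- the structure is that of the free symmetric algebra with polynomial differentiation
      (∀ M : SemimoduleCat.{u} R, D.Δ (op M) = (symMul R M).op) ∧
      (∀ M : SemimoduleCat.{u} R, D.e (op M) = (symUnit R M).op) ∧
      (∀ M N : SemimoduleCat.{u} R, D.m (op M) (op N) = (symComonoidal R M N).op) ∧
      D.mUnit = (symComonoidalUnit R).op ∧
      (∀ M : SemimoduleCat.{u} R, D.d (op M) = (symDeriving R M).op) ∧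
      (∀ p : Polynomial R, asPolynomialMap R D.dUnit p = Polynomial.derivative p) ∧
      -- it has antiderivatives, and integration over the unit is polynomial integration
      ∃ h : D.HasAntiderivatives,
        D.SatisfiesFTC2 (D.integralUnit h) ∧
        ∀ p : Polynomial R, asPolynomialMap R (D.integralUnit h) p = polynomialIntegral hR p :=
  ⟨symDifferentialLinearStructure R, fun _ => rfl, fun _ => rfl, fun _ _ => rfl, rfl, fun _ => rfl,
    asPolynomialMap_dUnit, symHasAntiderivatives hR, symSatisfiesFTC2 hR _,
    asPolynomialMap_integralUnit hR _⟩
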